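/- Let $\Phi$ be a countable set of atomic propositions, let $X$ be a variable, and fix $t\in\Phi$. \emph{Operator forms} of the one-variable modal $\mu$-calculus are $$A ::= p \mid \bar p \mid X \mid A\land A \mid A\lor A \mid \Box A \mid \Diamond A \mid \mu X.A \mid \nu X.A \qquad (p\in\Phi),$$ and \emph{formulae} are the operator forms without free occurrences of $X$. Negation is defined by $\lnot p=\bar p$, $\lnot\bar p=p$, $\lnot X=X$ and the usual dualities between $\land$ and $\lor$, $\Box$ and $\Diamond$, $\mu$ and $\nu$ (so $\lnot\mu X.A=\nu X.\lnot A$ and $\lnot\nu X.A=\mu X.\lnot A$). Write $A(B)$ for the result of substituting the formula $B$ for all free occurrences of $X$ in the operator form $A$, $A^0(B)=B$, $A^{i+1}(B)=A(A^i(B))$, and $\top=t\lor\bar t$. An $\mathcal L_0$-\emph{sequent} is a finite set of formulae; $\Gamma,A$ denotes $\Gamma\cup\{A\}$, and $\Diamond\Gamma=\{\Diamond A: A\in\Gamma\}$. The infinitary cut-free system $\mathsf{Mu}^\infty$ has the axioms $\Gamma,p,\bar p$ and the rules $$\frac{\Gamma,A,B}{\Gamma,A\lor B}\quad \frac{\Gamma,A\qquad\Gamma,B}{\Gamma,A\land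 B}\quad \frac{\Gamma,A}{\Diamond\Gamma,\Box A,\Sigma}\quad \frac{\Gamma,A(\mu X.A)}{\Gamma,\mu X.A}\quad \frac{\Gamma,A^i(\top)\ \text{ for all } i\in\mathbb N}{\Gamma,\nu X.A}.$$ The finitary system $\mathsf{Mu}$ has the axioms $\Gamma,p,\bar p$ and $\Gamma,\mu X.A,\lnot\mu X.A$, the first four of these rules, and, for formulae $B$, $C$ and operator forms $A$, the induction and cut rules $$\frac{\lnot (A(B)),\,B}{\lnot\mu X.A,\,B}\qquad \frac{\Gamma,C\qquad\Gamma,\lnot C}{\Gamma}.$$ Then: 1. For every $\mathcal L_0$-sequent $\Gamma$, if $\Gamma$ is derivable in $\mathsf{Mu}$, then $\Gamma$ is derivable in $\mathsf{Mu}^\infty$. 2. $\mathsf{Mu}^\infty$ has the subformula property: in every $\mathsf{Mu}^\infty$-derivation of a sequent $\Gamma$, every formula of every sequent occurring in the derivation is a subformula of some formula in $\Gamma$. Here the subformula relation is the least reflexive and transitive relation on formulae such that $F$ and $G$ are subformulae of $F\land G$ and of $F\lor G$, $F$ is a subformula of $\Box F$ and of $\Diamond F$, $A(\mu X.A)$ is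 a subformula of $\mu X.A$, and $A^i(\top)$ is a subformula of $\nu X.A$ for every $i\in\mathbb N$. -/

import Mathlib

namespace ModalMu

universe u

/-- Operator forms of the one-variable modal mu-calculus: `atom p` is the atomic proposition `p`,
`natom p` is its negation, `var` is the only variable `X`, and `mu`, `nu` bind `X`. -/
inductive OpForm (Atom : Type u) : Type u where
  | atom : Atom → OpForm Atom
  | natom : Atom → OpForm Atom
  | var : OpForm Atom
  | and : OpForm Atom → OpForm Atom → OpForm Atom
  | or : OpForm Atom → OpForm Atom → OpForm Atom
  | box : OpForm Atom → OpForm Atom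
  | dia : OpForm Atom → OpForm Atom
  | mu : OpForm Atom → OpForm Atom
  | nu : OpForm Atom → OpForm Atom

namespace OpForm

variable {Atom : Type u}

/-- The operator form has no free occurrence of `X`. -/
def Closed : OpForm Atom → Prop
  | atom _ => True
  | natom _ => True
  | var => False
  | and A B => A.Closed ∧ B.Closed
  | or A B => A.Closed ∧ B.Closed
  | box A => A.Closed
  | dia A => A.Closed
  | mu _ => True
  | nu _ => True

/-- The negation of an operator form (with `¬X = X`). -/
def neg : OpForm Atom → OpForm Atom
  | atom p => natom p
  | natom p => atom p
  | var => var
  | and A B => or A.neg B.neg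
  | or A B => and A.neg B.neg
  | box A => dia A.neg
  | dia A => box A.neg
  | mu A => nu A.neg
  | nu A => mu A.neg

/-- `A.subst B` is `A(B)`: every free occurrence of `X` in `A` is replaced by `B`. -/
def subst : OpForm Atom → OpForm Atom → OpForm Atom
  | atom p, _ => atom p
  | natom p, _ => natom p
  | var, B => B
  | and A C, B => and (A.subst B) (C.subst B)
  | or A C, B => or (A.subst B) (C.subst B)
  | box A, B => box (A.subst B)
  | dia A, B => dia (A.subst B)
  | mu A, _ => mu A
  | nu A, _ => nu A

theorem Closed.neg {A : OpForm Atom} (h : A.Closed) : A.neg.Closed := by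
  induction A <;> simp_all [OpForm.neg, Closed]

theorem closed_subst (A : OpForm Atom) {B : OpForm Atom} (h : B.Closed) :
    (A.subst B).Closed := by
  induction A <;> simp_all [OpForm.subst, Closed]

end OpForm

/-- Formulae: operator forms without free occurrences of `X`. -/
def Formula (Atom : Type u) : Type u := {A : OpForm Atom // A.Closed}

namespace Formula

variable {Atom : Type u}

noncomputable instance : DecidableEq (Formula Atom) := Classical.decEq _

def atom (p : Atom) : Formula Atom := ⟨.atom p, trivial⟩

def natom (p : Atom) : Formula Atom := ⟨.natom p, trivial⟩

def and (F G : Formula Atom) : Formula Atom := ⟨.and F.1 G.1, F.2, G.2⟩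

def or (F G : Formula Atom) : Formula Atom := ⟨.or F.1 G.1, F.2, G.2⟩

def box (F : Formula Atom) : Formula Atom := ⟨.box F.1, F.2⟩

def dia (F : Formula Atom) : Formula Atom := ⟨.dia F.1, F.2⟩

/-- The formula `μX.A`. -/
def mu (A : OpForm Atom) : Formula Atom := ⟨.mu A, trivial⟩

/-- The formula `νX.A`. -/
def nu (A : OpForm Atom) : Formula Atom := ⟨.nu A, trivial⟩

def neg (F : Formula Atom) : Formula Atom := ⟨F.1.neg, F.2.neg⟩

/-- The formula `⊤ := t ∨ ¬t`, for a fixed atomic proposition `t`. -/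
def top (t : Atom) : Formula Atom := or (atom t) (natom t)

end Formula

/-- `A.app F` is the formula `A(F)`. -/
def OpForm.app {Atom : Type u} (A : OpForm Atom) (F : Formula Atom) : Formula Atom :=
  ⟨A.subst F.1, A.closed_subst F.2⟩

/-- `A.iter i F` is `A^i(F)`, where `A^0(F) = F` and `A^(i+1)(F) = A(A^i(F))`. -/
def OpForm.iter {Atom : Type u} (A : OpForm Atom) : ℕ → Formula Atom → Formula Atom
  | 0, F => F
  | i + 1, F => A.app (A.iter i F)

/-- Sequents: finite sets of formulae. -/
abbrev Sequent (Atom : Type u) : Type u := Finset (Formula Atom)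

/-- `◇Γ`. -/
noncomputable def diaSeq {Atom : Type u} (Γ : Sequent Atom) : Sequent Atom := Γ.image Formula.dia

/-- Derivability in the finitary system with cut and the induction rule. -/
inductive Mu {Atom : Type u} : Sequent Atom → Prop where
  | ax (Γ : Sequent Atom) (p : Atom) :
      Mu (insert (Formula.atom p) (insert (Formula.natom p) Γ))
  | axMu (Γ : Sequent Atom) (A : OpForm Atom) :
      Mu (insert (Formula.mu A) (insert (Formula.mu A).neg Γ))
  | or (Γ : Sequent Atom) (F G : Formula Atom) :
      Mu (insert F (insert G Γ)) → Mu (insert (F.or G) Γ)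
  | and (Γ : Sequent Atom) (F G : Formula Atom) :
      Mu (insert F Γ) → Mu (insert G Γ) → Mu (insert (F.and G) Γ)
  | box (Γ Θ : Sequent Atom) (F : Formula Atom) :
      Mu (insert F Γ) → Mu (insert F.box (diaSeq Γ ∪ Θ))
  | clo (Γ : Sequent Atom) (A : OpForm Atom) :
      Mu (insert (A.app (Formula.mu A)) Γ) → Mu (insert (Formula.mu A) Γ)
  | ind (A : OpForm Atom) (F : Formula Atom) :
      Mu {(A.app F).neg, F} → Mu {(Formula.mu A).neg, F}
  | cut (Γ : Sequent Atom) (F : Formula Atom) :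
      Mu (insert F Γ) → Mu (insert F.neg Γ) → Mu Γ

/-- `MuInf t Γ` is the type of derivations of `Γ` in the infinitary cut-free system, in which
`⊤` is `t ∨ ¬t`. Derivations are well-founded trees; the rule `nu` has one premise for each
natural number. -/
inductive MuInf {Atom : Type u} (t : Atom) : Sequent Atom → Type u where
  | ax (Γ : Sequent Atom) (p : Atom) :
      MuInf t (insert (Formula.atom p) (insert (Formula.natom p) Γ))
  | or (Γ : Sequent Atom) (F G : Formula Atom) :
      MuInf t (insert F (insert G Γ)) → MuInf t (insert (F.or G) Γ)
  | and (Γ : Sequent Atom) (F G : Formula Atom) :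
      MuInf t (insert F Γ) → MuInf t (insert G Γ) → MuInf t (insert (F.and G) Γ)
  | box (Γ Θ : Sequent Atom) (F : Formula Atom) :
      MuInf t (insert F Γ) → MuInf t (insert F.box (diaSeq Γ ∪ Θ))
  | clo (Γ : Sequent Atom) (A : OpForm Atom) :
      MuInf t (insert (A.app (Formula.mu A)) Γ) → MuInf t (insert (Formula.mu A) Γ)
  | nu (Γ : Sequent Atom) (A : OpForm Atom) :
      (∀ i : ℕ, MuInf t (insert (A.iter i (Formula.top t)) Γ)) → MuInf t (insert (Formula.nu A) Γ)

/-- The set of all sequents that occur in a derivation, the end sequent included. -/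
def MuInf.sequents {Atom : Type u} {t : Atom} : {Γ : Sequent Atom} → MuInf t Γ → Set (Sequent Atom)
  | _, ax Γ p => {insert (Formula.atom p) (insert (Formula.natom p) Γ)}
  | _, or Γ F G d => insert (insert (F.or G) Γ) d.sequents
  | _, and Γ F G d e => insert (insert (F.and G) Γ) (d.sequents ∪ e.sequents)
  | _, box Γ Θ F d => insert (insert F.box (diaSeq Γ ∪ Θ)) d.sequents
  | _, clo Γ A d => insert (insert (Formula.mu A) Γ) d.sequents
  | _, nu Γ A d => insert (insert (Formula.nu A) Γ) (⋃ i : ℕ, (d i).sequents)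

/-- `DirectSubformula t F G`: `F` is a direct subformula of `G`. As usual for fixed point logics,
the direct subformula of `μX.A` is its unfolding `A(μX.A)`, and those of `νX.A`, which is read as
the infinite conjunction of its finite approximations, are the formulae `A^i(⊤)`. -/
inductive DirectSubformula {Atom : Type u} (t : Atom) : Formula Atom → Formula Atom → Prop where
  | and_left (F G : Formula Atom) : DirectSubformula t F (F.and G)
  | and_right (F G : Formula Atom) : DirectSubformula t G (F.and G)
  | or_left (F G : Formula Atom) : DirectSubformula t F (F.or G)
  | or_right (F G : Formula Atom) : DirectSubformula t G (F.or G)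
  | box (F : Formula Atom) : DirectSubformula t F F.box
  | dia (F : Formula Atom) : DirectSubformula t F F.dia
  | mu (A : OpForm Atom) : DirectSubformula t (A.app (Formula.mu A)) (Formula.mu A)
  | nu (A : OpForm Atom) (i : ℕ) :
      DirectSubformula t (A.iter i (Formula.top t)) (Formula.nu A)

/-- The subformula relation: the reflexive transitive closure of `DirectSubformula`. -/
def Subformula {Atom : Type u} (t : Atom) : Formula Atom → Formula Atom → Prop :=
  Relation.ReflTransGen (DirectSubformula t)

end ModalMu

/-!
The inclusion of `Mu` in `MuInf` is proved semantically, through Kripke models, so that no cut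
elimination procedure is needed.

`Mu` is sound: a sequent derivable in `Mu` has a true member at every world of every Kripke model
(`Mu.sound`). Conversely, a sequent without a `MuInf`-derivation is refuted at some world of the
canonical model, whose worlds are the underivable finite sequents that are saturated, that is, closed
under reading the rules for `∨`, `∧`, `μ`, `ν` backwards (`IsSaturated`), and in which `T` is
accessible from `S` when `◇F ∈ S` implies `F ∈ T`. Two facts carry this completeness proof, and both
go by structural induction on operator forms, which suffices because a substitution `A(B)` never
enters the scope of a fixed point.

* Every underivable sequent extends to a saturated one that is still finite
  (`exists_saturated_superset`). Finiteness is essential, since the rule for `□` has to be applied to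
  the world as a sequent. A chain of unfoldings stops because `A(μX.A)` leads back only to `μX.A`,
  which is already present, and to forms structurally simpler than `μX.A`; for `νX.A` the rule selects
  one approximation `A^i(⊤)`, which is treated by induction on `i`.
* Every member of a world is false there (`canonical_not_mem_denot`). For `μX.A`, the set of worlds
  that do not contain `μX.A` is closed under the operator of `A`, hence includes the least fixed point.
  For `νX.A`, the world contains some `A^i(⊤)`, and by induction on `i` no world containing `A^i(⊤)`
  lies in a set `Q` that the operator of `A` maps to a superset of `Q`.

The subformula property is an induction on derivations: every formula of a premise is a subformula of
a formula of the conclusion.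
-/

namespace ModalMu

universe v

variable {Atom : Type u}

/-! ### Substitution into closed forms -/

theorem OpForm.subst_eq_self {A : OpForm Atom} (h : A.Closed) (B : OpForm Atom) :
    A.subst B = A := by
  induction A <;> simp_all [OpForm.Closed, OpForm.subst]

theorem Formula.app_eq_self (F G : Formula Atom) : F.1.app G = F :=
  Subtype.ext (OpForm.subst_eq_self F.2 G.1)

/-! ### Kripke semantics -/

/-- A Kripke model: an accessibility relation on `W` and a valuation of the atoms. -/
structure KripkeModel (Atom : Type u) (W : Type v) where
  /-- accessibility -/
  rel : W → W → Prop
  /-- the set of worlds at which an atom is true -/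
  val : Atom → Set W

namespace KripkeModel

variable {W : Type v} (M : KripkeModel Atom W)

/-- The set of worlds at which an operator form is true when `X` is interpreted by `P`. The fixed
points are given by the Knaster–Tarski formulas. -/
def denot : OpForm Atom → Set W → Set W
  | .atom p, _ => M.val p
  | .natom p, _ => (M.val p)ᶜ
  | .var, P => P
  | .and A B, P => denot A P ∩ denot B P
  | .or A B, P => denot A P ∪ denot B P
  | .box A, P => {w | ∀ v, M.rel w v → v ∈ denot A P}
  | .dia A, P => {w | ∃ v, M.rel w v ∧ v ∈ denot A P}
  | .mu A, _ => {w | ∀ P : Set W, denot A P ⊆ P → w ∈ P}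
  | .nu A, _ => {w | ∃ P : Set W, P ⊆ denot A P ∧ w ∈ P}

theorem denot_mono (A : OpForm Atom) : Monotone (M.denot A) := by
  intro P Q h
  induction A with
  | atom | natom | mu | nu => exact le_rfl
  | var => exact h
  | and A B hA hB => exact Set.inter_subset_inter hA hB
  | or A B hA hB => exact Set.union_subset_union hA hB
  | box A hA => exact fun w hw v hv => hA (hw v hv)
  | dia A hA => exact fun w ⟨v, hv, hw⟩ => ⟨v, hv, hA hw⟩

theorem denot_neg (A : OpForm Atom) (P : Set W) : M.denot A.neg Pᶜ = (M.denot A P)ᶜ := by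
  induction A generalizing P with
  | atom p | var => rfl
  | natom p => simp [OpForm.neg, denot]
  | and A B hA hB => simp [OpForm.neg, denot, hA, hB, Set.compl_inter]
  | or A B hA hB => simp [OpForm.neg, denot, hA, hB, Set.compl_union]
  | box A hA | dia A hA => ext w; simp [OpForm.neg, denot, hA]
  | mu A hA =>
    ext w
    simp only [OpForm.neg, denot, Set.mem_ofPred_eq, Set.mem_compl_iff, not_forall]
    constructor
    · rintro ⟨P, hP, hw⟩
      refine ⟨Pᶜ, ?_, fun h => h hw⟩
      rw [← compl_compl P, hA, compl_compl] at hP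
      exact Set.subset_compl_comm.1 hP
    · rintro ⟨P, hP, hw⟩
      exact ⟨Pᶜ, by rw [hA]; exact Set.compl_subset_compl.2 hP, hw⟩
  | nu A hA =>
    ext w
    simp only [OpForm.neg, denot, Set.mem_ofPred_eq, Set.mem_compl_iff, not_exists, not_and]
    constructor
    · intro h P hP hw
      exact h Pᶜ (by rw [hA]; exact Set.compl_subset_compl.2 hP) hw
    · intro h P hP
      by_contra hw
      refine h Pᶜ ?_ hw
      rw [← compl_compl P, hA, compl_compl] at hP
      exact Set.compl_subset_comm.1 hP

theorem denot_eq_of_closed {A : OpForm Atom} (h : A.Closed) (P Q : Set W) :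
    M.denot A P = M.denot A Q := by
  induction A <;> simp_all [OpForm.Closed, denot]

theorem denot_subst (A B : OpForm Atom) (P : Set W) :
    M.denot (A.subst B) P = M.denot A (M.denot B P) := by
  induction A <;> simp_all [OpForm.subst, denot]

/-- The truth set of a formula; the value of `X` is irrelevant. -/
def truth (F : Formula Atom) : Set W := M.denot F.1 ∅

theorem truth_neg (F : Formula Atom) : M.truth F.neg = (M.truth F)ᶜ := by
  rw [truth, truth, ← denot_neg]
  exact M.denot_eq_of_closed F.neg.2 _ _

theorem truth_app (A : OpForm Atom) (F : Formula Atom) :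
    M.truth (A.app F) = M.denot A (M.truth F) :=
  M.denot_subst A F.1 ∅

theorem truth_mu_subset {A : OpForm Atom} {P : Set W} (h : M.denot A P ⊆ P) :
    M.truth (Formula.mu A) ⊆ P :=
  fun _ hw => hw P h

theorem denot_truth_mu_subset (A : OpForm Atom) :
    M.denot A (M.truth (Formula.mu A)) ⊆ M.truth (Formula.mu A) :=
  fun _ hw _ hP => hP (M.denot_mono A (M.truth_mu_subset hP) hw)

end KripkeModel

/-- Soundness of the finitary system for all Kripke models. -/
theorem Mu.sound {W : Type v} (M : KripkeModel Atom W) {Γ : Sequent Atom} (h : Mu Γ) (w : W) :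
    ∃ F ∈ Γ, w ∈ M.truth F := by
  induction h generalizing w with
  | ax Γ p =>
    by_cases hw : w ∈ M.val p
    · exact ⟨Formula.atom p, by simp, hw⟩
    · exact ⟨Formula.natom p, by simp, hw⟩
  | axMu Γ A =>
    by_cases hw : w ∈ M.truth (Formula.mu A)
    · exact ⟨Formula.mu A, by simp, hw⟩
    · exact ⟨(Formula.mu A).neg, by simp, by rwa [M.truth_neg]⟩
  | or Γ F G _ ih =>
    obtain ⟨H, hH, hw⟩ := ih w
    rw [Finset.mem_insert, Finset.mem_insert] at hH
    obtain rfl | rfl | hH := hH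
    · exact ⟨_, Finset.mem_insert_self _ _, Or.inl hw⟩
    · exact ⟨_, Finset.mem_insert_self _ _, Or.inr hw⟩
    · exact ⟨H, Finset.mem_insert_of_mem hH, hw⟩
  | and Γ F G _ _ ihF ihG =>
    obtain ⟨H, hH, hw⟩ := ihF w
    obtain ⟨K, hK, hw'⟩ := ihG w
    obtain rfl | hH := Finset.mem_insert.1 hH
    · obtain rfl | hK := Finset.mem_insert.1 hK
      · exact ⟨_, Finset.mem_insert_self _ _, hw, hw'⟩
      · exact ⟨K, Finset.mem_insert_of_mem hK, hw'⟩
    · exact ⟨H, Finset.mem_insert_of_mem hH, hw⟩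
  | box Γ Θ F _ ih =>
    by_cases hw : w ∈ M.truth F.box
    · exact ⟨_, Finset.mem_insert_self _ _, hw⟩
    · obtain ⟨v, hv, hF⟩ : ∃ v, M.rel w v ∧ v ∉ M.truth F := by
        by_contra! h
        exact hw h
      obtain ⟨H, hH, hvH⟩ := ih v
      obtain rfl | hH := Finset.mem_insert.1 hH
      · exact absurd hvH hF
      · exact ⟨H.dia, Finset.mem_insert_of_mem
          (Finset.mem_union_left _ (Finset.mem_image_of_mem _ hH)), v, hv, hvH⟩
  | clo Γ A _ ih =>
    obtain ⟨H, hH, hw⟩ := ih w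
    obtain rfl | hH := Finset.mem_insert.1 hH
    · rw [M.truth_app] at hw
      exact ⟨_, Finset.mem_insert_self _ _, M.denot_truth_mu_subset A hw⟩
    · exact ⟨H, Finset.mem_insert_of_mem hH, hw⟩
  | ind A F _ ih =>
    -- The premise, being true at all worlds, says that the truth set of `F` is closed under `A`.
    have hF : M.truth (Formula.mu A) ⊆ M.truth F := by
      refine M.truth_mu_subset fun v hv => ?_
      obtain ⟨H, hH, hvH⟩ := ih v
      rw [Finset.mem_insert, Finset.mem_singleton] at hH
      obtain rfl | rfl := hH
      · rw [M.truth_neg, M.truth_app] at hvH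
        exact absurd hv hvH
      · exact hvH
    by_cases hw : w ∈ M.truth (Formula.mu A)
    · exact ⟨F, by simp, hF hw⟩
    · exact ⟨(Formula.mu A).neg, by simp, by rwa [M.truth_neg]⟩
  | cut Γ F _ _ ihF ihN =>
    obtain ⟨H, hH, hw⟩ := ihF w
    obtain ⟨K, hK, hw'⟩ := ihN w
    obtain rfl | hH := Finset.mem_insert.1 hH
    · obtain rfl | hK := Finset.mem_insert.1 hK
      · rw [M.truth_neg] at hw'
        exact absurd hw hw'
      · exact ⟨K, hK, hw'⟩
    · exact ⟨H, hH, hw⟩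

/-! ### Saturated sequents -/

/-- `IsReduced t Δ F`: if `F` is the principal formula of a rule for `∨`, `∧`, `μ` or `ν`, then `Δ`
contains the active formulas of one of the premises. There is no condition on literals and modal
formulas. -/
def IsReduced (t : Atom) (Δ : Sequent Atom) (F : Formula Atom) : Prop :=
  (∀ G H : Formula Atom, F = G.or H → G ∈ Δ ∧ H ∈ Δ) ∧
  (∀ G H : Formula Atom, F = G.and H → G ∈ Δ ∨ H ∈ Δ) ∧
  (∀ A, F = Formula.mu A → A.app (Formula.mu A) ∈ Δ) ∧
  (∀ A, F = Formula.nu A → ∃ i, A.iter i (Formula.top t) ∈ Δ)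

theorem IsReduced.mono {t : Atom} {Δ Δ' : Sequent Atom} {F : Formula Atom} (h : Δ ⊆ Δ')
    (hF : IsReduced t Δ F) : IsReduced t Δ' F :=
  ⟨fun G H e => ⟨h (hF.1 G H e).1, h (hF.1 G H e).2⟩,
    fun G H e => (hF.2.1 G H e).imp (@h _) (@h _), fun A e => h (hF.2.2.1 A e),
    fun A e => (hF.2.2.2 A e).imp fun _ hi => h hi⟩

theorem isReduced_or {t : Atom} {Δ : Sequent Atom} {F G : Formula Atom} (hF : F ∈ Δ)
    (hG : G ∈ Δ) : IsReduced t Δ (F.or G) := by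
  refine ⟨fun F' G' e => ?_, fun _ _ e => ?_, fun _ e => ?_, fun _ e => ?_⟩
  · obtain ⟨h1, h2⟩ := OpForm.or.inj (congrArg Subtype.val e)
    rw [← Subtype.ext h1, ← Subtype.ext h2]
    exact ⟨hF, hG⟩
  all_goals exact nomatch congrArg Subtype.val e

theorem isReduced_and {t : Atom} {Δ : Sequent Atom} {F G : Formula Atom} (h : F ∈ Δ ∨ G ∈ Δ) :
    IsReduced t Δ (F.and G) := by
  refine ⟨fun _ _ e => ?_, fun F' G' e => ?_, fun _ e => ?_, fun _ e => ?_⟩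
  · exact nomatch congrArg Subtype.val e
  · obtain ⟨h1, h2⟩ := OpForm.and.inj (congrArg Subtype.val e)
    rw [← Subtype.ext h1, ← Subtype.ext h2]
    exact h
  all_goals exact nomatch congrArg Subtype.val e

theorem isReduced_mu {t : Atom} {Δ : Sequent Atom} {A : OpForm Atom}
    (h : A.app (Formula.mu A) ∈ Δ) : IsReduced t Δ (Formula.mu A) := by
  refine ⟨fun _ _ e => ?_, fun _ _ e => ?_, fun B e => ?_, fun _ e => ?_⟩
  on_goal 3 => exact OpForm.mu.inj (congrArg Subtype.val e) ▸ h
  all_goals exact nomatch congrArg Subtype.val e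

theorem isReduced_nu {t : Atom} {Δ : Sequent Atom} {A : OpForm Atom} {i : ℕ}
    (h : A.iter i (Formula.top t) ∈ Δ) : IsReduced t Δ (Formula.nu A) := by
  refine ⟨fun _ _ e => ?_, fun _ _ e => ?_, fun _ e => ?_, fun B e => ?_⟩
  on_goal 4 => exact OpForm.nu.inj (congrArg Subtype.val e) ▸ ⟨i, h⟩
  all_goals exact nomatch congrArg Subtype.val e

/-- All members of the sequent are reduced in it. -/
def IsSaturated (t : Atom) (Δ : Sequent Atom) : Prop := ∀ F ∈ Δ, IsReduced t Δ F

/-- `Reducible t X F`: whenever `Γ` includes `X` and `Γ, F` is underivable, the proof search for `F`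
terminates on some branch with an underivable sequent, in the sense that all formulas it adds to `Γ`
are reduced. Nothing is asked about `F` if `F ∈ Γ`; this is what stops the unfolding of `μX.A`, once
`μX.A` is in `X`. -/
def Reducible (t : Atom) (X : Set (Formula Atom)) (F : Formula Atom) : Prop :=
  ∀ Γ : Sequent Atom, X ⊆ ↑Γ → IsEmpty (MuInf t (insert F Γ)) →
    ∃ Δ : Sequent Atom, IsEmpty (MuInf t Δ) ∧ insert F Γ ⊆ Δ ∧ ∀ G ∈ Δ, G ∉ Γ → IsReduced t Δ G

namespace Reducible

variable {t : Atom} {X : Set (Formula Atom)}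

theorem of_mem {F : Formula Atom} (h : F ∈ X) : Reducible t X F := by
  intro Γ hX hΓ
  refine ⟨_, hΓ, Finset.Subset.refl _, fun G hG hG' => ?_⟩
  obtain rfl | hG := Finset.mem_insert.1 hG
  · exact absurd (hX h) hG'
  · exact absurd hG hG'

theorem of_isReduced {F : Formula Atom} (h : ∀ Δ, IsReduced t Δ F) : Reducible t X F := by
  intro Γ _ hΓ
  refine ⟨_, hΓ, Finset.Subset.refl _, fun G hG hG' => ?_⟩
  obtain rfl | hG := Finset.mem_insert.1 hG
  · exact h _
  · exact absurd hG hG'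

/-- The step common to the rules with one active formula: `G` is added to the sequent, which keeps
its principal formula `F`, and the search continues with `G`. -/
theorem of_step {F G : Formula Atom} {Γ : Sequent Atom} (hG : Reducible t (insert F X) G)
    (hX : X ⊆ ↑Γ) (hΓ : IsEmpty (MuInf t (insert G (insert F Γ))))
    (hF : ∀ Δ : Sequent Atom, G ∈ Δ → IsReduced t Δ F) :
    ∃ Δ : Sequent Atom, IsEmpty (MuInf t Δ) ∧ insert F Γ ⊆ Δ ∧
      ∀ H ∈ Δ, H ∉ Γ → IsReduced t Δ H := by
  obtain ⟨Δ, h1, h2, h3⟩ := hG (insert F Γ)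
    (by rw [Finset.coe_insert]; exact Set.insert_subset_insert hX) hΓ
  refine ⟨Δ, h1, (Finset.subset_insert _ _).trans h2, fun H hH hH' => ?_⟩
  by_cases e : H = F
  · exact e ▸ hF Δ (h2 (Finset.mem_insert_self _ _))
  · exact h3 H hH (by simp [e, hH'])

theorem mono {Y : Set (Formula Atom)} {F : Formula Atom} (h : X ⊆ Y) (hF : Reducible t X F) :
    Reducible t Y F :=
  fun Γ hY => hF Γ (h.trans hY)

theorem and {F G : Formula Atom} (hF : Reducible t X F) (hG : Reducible t X G) :
    Reducible t X (F.and G) := by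
  intro Γ hX hΓ
  have h : IsEmpty (MuInf t (insert F (insert (F.and G) Γ))) ∨
      IsEmpty (MuInf t (insert G (insert (F.and G) Γ))) := by
    by_contra! h
    obtain ⟨⟨d⟩, ⟨e⟩⟩ := h
    exact hΓ.false (by simpa using MuInf.and _ F G d e)
  obtain h | h := h
  · exact of_step (hF.mono (Set.subset_insert _ _)) hX h fun _ hΔ => isReduced_and (.inl hΔ)
  · exact of_step (hG.mono (Set.subset_insert _ _)) hX h fun _ hΔ => isReduced_and (.inr hΔ)

theorem or {F G : Formula Atom} (hF : Reducible t X F) (hG : Reducible t X G) :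
    Reducible t X (F.or G) := by
  intro Γ hX hΓ
  have h : IsEmpty (MuInf t (insert F (insert G (insert (F.or G) Γ)))) :=
    ⟨fun d => hΓ.false (by simpa using MuInf.or _ F G d)⟩
  obtain ⟨Δ, h1, h2, h3⟩ := hF (insert G (insert (F.or G) Γ))
    (hX.trans (by intro; simp +contextual)) h
  have hFΔ : F ∈ Δ := h2 (by simp)
  have hGΔ : G ∈ Δ := h2 (by simp)
  have hsub : insert (F.or G) Γ ⊆ Δ :=
    ((Finset.subset_insert _ _).trans (Finset.subset_insert _ _)).trans h2
  -- The only formula added to `Γ` that is possibly not yet reduced in `Δ` is `G`.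
  have h4 : ∀ H ∈ Δ, H ∉ Γ → H ≠ G → IsReduced t Δ H := fun H hH hH' hne => by
    by_cases e : H = F.or G
    · exact e ▸ isReduced_or hFΔ hGΔ
    · exact h3 H hH (by simp [e, hne, hH'])
  by_cases hGΓ : G ∈ Γ
  · exact ⟨Δ, h1, hsub, fun H hH hH' => h4 H hH hH' fun e => hH' (e ▸ hGΓ)⟩
  have hX' : X ⊆ ↑(Δ.erase G) := fun H hH => by
    refine Finset.mem_erase.2 ⟨?_, hsub (Finset.mem_insert_of_mem (hX hH))⟩
    rintro rfl
    exact hGΓ (hX hH)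
  obtain ⟨Δ', k1, k2, k3⟩ := hG (Δ.erase G) hX' (by rwa [Finset.insert_erase hGΔ])
  rw [Finset.insert_erase hGΔ] at k2
  refine ⟨Δ', k1, hsub.trans k2, fun H hH hH' => ?_⟩
  by_cases hHΔ : H ∈ Δ.erase G
  · obtain ⟨hne, hHΔ⟩ := Finset.mem_erase.1 hHΔ
    exact (h4 H hHΔ hH' hne).mono k2
  · exact k3 H hH hHΔ

theorem atom (p : Atom) : Reducible t X (Formula.atom p) :=
  of_isReduced fun _ => ⟨fun _ _ e => (nomatch congrArg Subtype.val e),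
    fun _ _ e => (nomatch congrArg Subtype.val e), fun _ e => (nomatch congrArg Subtype.val e),
    fun _ e => (nomatch congrArg Subtype.val e)⟩

theorem natom (p : Atom) : Reducible t X (Formula.natom p) :=
  of_isReduced fun _ => ⟨fun _ _ e => (nomatch congrArg Subtype.val e),
    fun _ _ e => (nomatch congrArg Subtype.val e), fun _ e => (nomatch congrArg Subtype.val e),
    fun _ e => (nomatch congrArg Subtype.val e)⟩

theorem box (F : Formula Atom) : Reducible t X F.box :=
  of_isReduced fun _ => ⟨fun _ _ e => (nomatch congrArg Subtype.val e),
    fun _ _ e => (nomatch congrArg Subtype.val e), fun _ e => (nomatch congrArg Subtype.val e),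
    fun _ e => (nomatch congrArg Subtype.val e)⟩

theorem dia (F : Formula Atom) : Reducible t X F.dia :=
  of_isReduced fun _ => ⟨fun _ _ e => (nomatch congrArg Subtype.val e),
    fun _ _ e => (nomatch congrArg Subtype.val e), fun _ e => (nomatch congrArg Subtype.val e),
    fun _ e => (nomatch congrArg Subtype.val e)⟩

/-- Reducibility passes from `F` to `A(F)`. In the case of `μX.B`, the induction hypothesis for `B` is
used with `μX.B` itself among the formulas that are already present. -/
theorem app (A : OpForm Atom) {X : Set (Formula Atom)} {F : Formula Atom}
    (hF : Reducible t X F) : Reducible t X (A.app F) := by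
  induction A generalizing X F with
  | atom p => exact atom p
  | natom p => exact natom p
  | var => exact hF
  | and A B hA hB => exact (hA hF).and (hB hF)
  | or A B hA hB => exact (hA hF).or (hB hF)
  | box A => exact box (A.app F)
  | dia A => exact dia (A.app F)
  | mu A hA =>
    intro Γ hX hΓ
    refine of_step (F := Formula.mu A) (hA (of_mem (Set.mem_insert _ _))) hX
      ⟨fun d => hΓ.false ?_⟩ fun _ hΔ => isReduced_mu hΔ
    have d' := MuInf.clo _ A d
    rwa [Finset.insert_idem] at d'
  | nu A hA =>
    intro Γ hX hΓ
    have hiter : ∀ i, Reducible t X (A.iter i (Formula.top t)) := fun i => by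
      induction i with
      | zero => exact (atom t).or (natom t)
      | succ i ih => exact hA ih
    obtain ⟨i, hi⟩ : ∃ i, IsEmpty
        (MuInf t (insert (A.iter i (Formula.top t)) (insert (Formula.nu A) Γ))) := by
      by_contra! h
      have d := MuInf.nu _ A fun i => (h i).some
      rw [Finset.insert_idem] at d
      exact hΓ.false d
    exact of_step (F := Formula.nu A) ((hiter i).mono (Set.subset_insert _ _)) hX hi
      fun _ hΔ => isReduced_nu hΔ

theorem all (F : Formula Atom) : Reducible t X F := by
  rw [← Formula.app_eq_self F (Formula.atom t)]
  exact app F.1 (atom t)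

end Reducible

theorem exists_saturated_superset {t : Atom} {Γ : Sequent Atom} (hΓ : IsEmpty (MuInf t Γ)) :
    ∃ Δ : Sequent Atom, IsEmpty (MuInf t Δ) ∧ Γ ⊆ Δ ∧ IsSaturated t Δ := by
  -- The members of `Γ` are reduced one after the other; `Θ` collects those already treated.
  have key : ∀ Θ : Sequent Atom, Θ ⊆ Γ → ∃ Δ : Sequent Atom, IsEmpty (MuInf t Δ) ∧ Γ ⊆ Δ ∧
      ∀ F ∈ Δ, F ∈ Θ ∨ F ∉ Γ → IsReduced t Δ F := by
    intro Θ
    induction Θ using Finset.induction_on with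
    | empty =>
      exact fun _ => ⟨Γ, hΓ, Finset.Subset.refl _, fun F hF h => by simp [hF] at h⟩
    | insert F Θ _ ih =>
      intro hΘ
      obtain ⟨Δ, h1, h2, h3⟩ := ih ((Finset.subset_insert _ _).trans hΘ)
      have hF : F ∈ Δ := h2 (hΘ (Finset.mem_insert_self _ _))
      obtain ⟨Δ', k1, k2, k3⟩ := Reducible.all (t := t) (X := ∅) F (Δ.erase F)
        (Set.empty_subset _) (by rwa [Finset.insert_erase hF])
      rw [Finset.insert_erase hF] at k2
      refine ⟨Δ', k1, h2.trans k2, fun G hG h => ?_⟩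
      by_cases hGΔ : G ∈ Δ.erase F
      · obtain ⟨hne, hGΔ⟩ := Finset.mem_erase.1 hGΔ
        exact (h3 G hGΔ (h.imp_left fun h => Finset.mem_of_mem_insert_of_ne h hne)).mono k2
      · exact k3 G hG hGΔ
  obtain ⟨Δ, h1, h2, h3⟩ := key Γ (Finset.Subset.refl _)
  exact ⟨Δ, h1, h2, fun F hF => h3 F hF (em _)⟩

/-! ### The canonical model -/

/-- The worlds of the canonical model: the underivable saturated sequents. -/
def CanonicalWorld (t : Atom) : Type u :=
  {Δ : Sequent Atom // IsEmpty (MuInf t Δ) ∧ IsSaturated t Δ}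

/-- The canonical model. A world is meant to refute all its members, whence the negation in the
valuation and the direction of the accessibility relation. -/
def canonicalModel (t : Atom) : KripkeModel Atom (CanonicalWorld t) where
  rel S T := ∀ F : Formula Atom, F.dia ∈ S.1 → F ∈ T.1
  val p := {S | Formula.atom p ∉ S.1}

theorem CanonicalWorld.not_atom_and_natom {t : Atom} (S : CanonicalWorld t) {p : Atom}
    (h : Formula.atom p ∈ S.1) (h' : Formula.natom p ∈ S.1) : False := by
  have d := MuInf.ax (t := t) S.1 p
  rw [Finset.insert_eq_of_mem h', Finset.insert_eq_of_mem h] at d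
  exact S.2.1.false d

theorem CanonicalWorld.exists_rel {t : Atom} (S : CanonicalWorld t) {F : Formula Atom}
    (h : F.box ∈ S.1) : ∃ T, (canonicalModel t).rel S T ∧ F ∈ T.1 := by
  have hinj : Function.Injective (Formula.dia (Atom := Atom)) := fun _ _ e =>
    Subtype.ext (OpForm.dia.inj (congrArg Subtype.val e))
  let Γ : Sequent Atom := S.1.preimage Formula.dia hinj.injOn
  have hΓ : diaSeq Γ ⊆ S.1 := by
    intro G hG
    obtain ⟨H, hH, rfl⟩ := Finset.mem_image.1 hG
    exact Finset.mem_preimage.1 hH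
  obtain ⟨Δ, h1, h2, h3⟩ := exists_saturated_superset (t := t) (Γ := insert F Γ) ⟨fun d => by
    have d' := MuInf.box Γ S.1 F d
    rw [Finset.union_eq_right.2 hΓ, Finset.insert_eq_of_mem h] at d'
    exact S.2.1.false d'⟩
  exact ⟨⟨Δ, h1, h3⟩,
    fun G hG => h2 (Finset.mem_insert_of_mem (Finset.mem_preimage.2 hG)),
    h2 (Finset.mem_insert_self _ _)⟩

/-- The truth lemma for operator forms: if the worlds containing `F` are outside `P`, then those
containing `A(F)` are outside the value of `A` at `P`. -/
theorem canonical_not_mem_denot (t : Atom) (A : OpForm Atom) (F : Formula Atom)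
    (P : Set (CanonicalWorld t)) (hP : ∀ S : CanonicalWorld t, F ∈ S.1 → S ∉ P)
    (S : CanonicalWorld t) (hS : A.app F ∈ S.1) : S ∉ (canonicalModel t).denot A P := by
  induction A generalizing F P S with
  | atom p => exact fun h => h hS
  | natom p => exact fun h => h fun h' => S.not_atom_and_natom h' hS
  | var => exact hP S hS
  | and A B hA hB =>
    rintro ⟨h1, h2⟩
    exact ((S.2.2 _ hS).2.1 (A.app F) (B.app F) rfl).elim (fun h => hA F P hP S h h1)
      (fun h => hB F P hP S h h2)
  | or A B hA hB =>
    obtain ⟨h1, h2⟩ := (S.2.2 _ hS).1 (A.app F) (B.app F) rfl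
    exact fun h => h.elim (hA F P hP S h1) (hB F P hP S h2)
  | box A hA =>
    obtain ⟨T, hT, hF⟩ := S.exists_rel (F := A.app F) hS
    exact fun h => hA F P hP T hF (h T hT)
  | dia A hA =>
    rintro ⟨T, hT, h⟩
    exact hA F P hP T (hT (A.app F) hS) h
  | mu A hA =>
    -- The worlds without `μX.A` form a set closed under `A`.
    intro h
    refine h {T | Formula.mu A ∉ T.1} (fun T hT hT' => ?_) hS
    exact hA (Formula.mu A) _ (fun _ h1 h2 => absurd h1 h2) T ((T.2.2 _ hT').2.2.1 A rfl) hT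
  | nu A hA =>
    rintro ⟨Q, hQ, hSQ⟩
    have hiter : ∀ i, ∀ T : CanonicalWorld t, A.iter i (Formula.top t) ∈ T.1 → T ∉ Q := by
      intro i
      induction i with
      | zero =>
        intro T hT
        obtain ⟨h1, h2⟩ := (T.2.2 _ hT).1 _ _ rfl
        exact (T.not_atom_and_natom h1 h2).elim
      | succ i ih => exact fun T hT hTQ => hA _ Q ih T hT (hQ hTQ)
    obtain ⟨i, hi⟩ := (S.2.2 _ hS).2.2.2 A rfl
    exact hiter i S hi hSQ

/-- Completeness of the infinitary system: a sequent with a true member at every world of the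
canonical model is derivable. -/
theorem nonempty_muInf_of_canonical {t : Atom} {Γ : Sequent Atom}
    (h : ∀ S, ∃ F ∈ Γ, S ∈ (canonicalModel t).truth F) : Nonempty (MuInf t Γ) := by
  by_contra hΓ
  obtain ⟨Δ, h1, h2, h3⟩ := exists_saturated_superset (not_nonempty_iff.1 hΓ)
  obtain ⟨F, hF, hS⟩ := h ⟨Δ, h1, h3⟩
  -- `F` has the form `A(G)` for `A := F` and any `G`; the value `∅` of `X` refutes all of them.
  exact canonical_not_mem_denot t F.1 F ∅ (fun _ _ => Set.notMem_empty _) ⟨Δ, h1, h3⟩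
    (by rw [Formula.app_eq_self]; exact h2 hF) hS

/-! ### The subformula property -/

/-- If every formula of `Γ` is a subformula of a formula of `Γ'`, then so is every subformula of a
formula of `Γ`. -/
theorem exists_subformula_trans {t : Atom} {Γ Γ' : Sequent Atom}
    (h : ∀ G ∈ Γ, ∃ H ∈ Γ', Subformula t G H) {F : Formula Atom}
    (hF : ∃ G ∈ Γ, Subformula t F G) : ∃ H ∈ Γ', Subformula t F H := by
  obtain ⟨G, hG, hFG⟩ := hF
  obtain ⟨H, hH, hGH⟩ := h G hG
  exact ⟨H, hH, hFG.trans hGH⟩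

theorem exists_subformula_of_mem_insert {t : Atom} {Γ : Sequent Atom} {F G : Formula Atom}
    (h : DirectSubformula t F G) :
    ∀ H ∈ insert F Γ, ∃ K ∈ insert G Γ, Subformula t H K := by
  intro H hH
  obtain rfl | hH := Finset.mem_insert.1 hH
  · exact ⟨G, Finset.mem_insert_self _ _, .single h⟩
  · exact ⟨H, Finset.mem_insert_of_mem hH, .refl⟩

theorem MuInf.subformula {t : Atom} {Γ : Sequent Atom} (d : MuInf t Γ) :
    ∀ Δ ∈ d.sequents, ∀ F ∈ Δ, ∃ G ∈ Γ, Subformula t F G := by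
  induction d with
  | ax Γ p =>
    rintro Δ rfl F hF
    exact ⟨F, hF, .refl⟩
  | or Γ F G d ih =>
    rintro Δ (rfl | hΔ) H hH
    · exact ⟨H, hH, .refl⟩
    · refine exists_subformula_trans (fun K hK => ?_) (ih Δ hΔ H hH)
      obtain rfl | hK := Finset.mem_insert.1 hK
      · exact ⟨_, Finset.mem_insert_self _ _, .single (.or_left _ _)⟩
      · exact exists_subformula_of_mem_insert (.or_right F G) K hK
  | and Γ F G d e ihd ihe =>
    rintro Δ (rfl | hΔ | hΔ) H hH
    · exact ⟨H, hH, .refl⟩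
    · exact exists_subformula_trans (exists_subformula_of_mem_insert (.and_left F G))
        (ihd Δ hΔ H hH)
    · exact exists_subformula_trans (exists_subformula_of_mem_insert (.and_right F G))
        (ihe Δ hΔ H hH)
  | box Γ Θ F d ih =>
    rintro Δ (rfl | hΔ) H hH
    · exact ⟨H, hH, .refl⟩
    · refine exists_subformula_trans (fun K hK => ?_) (ih Δ hΔ H hH)
      obtain rfl | hK := Finset.mem_insert.1 hK
      · exact ⟨_, Finset.mem_insert_self _ _, .single (.box _)⟩
      · exact ⟨K.dia, Finset.mem_insert_of_mem
          (Finset.mem_union_left _ (Finset.mem_image_of_mem _ hK)), .single (.dia K)⟩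
  | clo Γ A d ih =>
    rintro Δ (rfl | hΔ) H hH
    · exact ⟨H, hH, .refl⟩
    · exact exists_subformula_trans (exists_subformula_of_mem_insert (.mu A)) (ih Δ hΔ H hH)
  | nu Γ A d ih =>
    rintro Δ (rfl | hΔ) H hH
    · exact ⟨H, hH, .refl⟩
    · obtain ⟨i, hΔ⟩ := Set.mem_iUnion.1 hΔ
      exact exists_subformula_trans (exists_subformula_of_mem_insert (.nu A i))
        (ih i Δ hΔ H hH)

end ModalMu

theorem mainTheorem1 {Atom : Type*} [Countable Atom] (t : Atom) :
    (∀ Γ : ModalMu.Sequent Atom, ModalMu.Mu Γ → Nonempty (ModalMu.MuInf t Γ)) ∧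
    (∀ (Γ : ModalMu.Sequent Atom) (d : ModalMu.MuInf t Γ), ∀ Δ ∈ d.sequents,
      ∀ F ∈ Δ, ∃ G ∈ Γ, ModalMu.Subformula t F G) := by
  exact ⟨fun _ h => ModalMu.nonempty_muInf_of_canonical (h.sound _),
    fun _ d => d.subformula⟩
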